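/- Let $(V,E)$ be an infinite, locally finite, connected graph. Let each edge $xy\in E$ carry a resistance $R_{xy}\in[0,\infty)$, an inductance $L_{xy}\in[0,\infty)$ and a capacitance $C_{xy}\in(0,\infty]$, put $D_{xy}=1/C_{xy}\in[0,\infty)$, and assume $R_{xy}+L_{xy}+D_{xy}>0$. For $\lambda\in\mathbb{C}\setminus\{0\}$ let $z_{xy}^{(\lambda)}=R_{xy}+L_{xy}\lambda+D_{xy}/\lambda$ and $\rho_{xy}^{(\lambda)}=1/z_{xy}^{(\lambda)}$ on edges, $\rho_{xy}^{(\lambda)}=0$ if $xy\notin E$. Let $a\in V$ and let $B\subset V$ be a possibly empty set with $a\notin B$. For $n\ge 1$ let $V_n=\{x: \operatorname{dist}(a,x)\le n\}$ for the graph distance, and $B_n=(B\cap V_n)\cup\{x:\operatorname{dist}(a,x)=n\}$. For $\lambda\neq0$ with $z^{(\lambda)}_{xy}\ne0$ on all edges, the effective admittance $\mathcal{P}_n(\lambda)\in\mathbb{C}\cup\{\infty\}$ of the finite network on $V_n$ (with all edges of $E$ between vertices of $V_n$) is $$\mathcal{P}_n(\lambda)=\sum_{x\in V_n}(1-v(x))\,\rho^{(\lambda)}_{xa},$$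 where $v:V_n\to\mathbb{C}$ is any solution of the Dirichlet problem $\sum_{y\in V_n}(v(y)-v(x))\rho^{(\lambda)}_{xy}=0$ for $x\in V_n\setminus(B_n\cup\{a\})$, $v=0$ on $B_n$, $v(a)=1$ (the value does not depend on the choice of $v$), and $\mathcal{P}_n(\lambda)=\infty$ if there is no solution. Assume that $R_{xy}=0$ for all $xy\in E$, and set $$S_D=\sup_{xy\in E}\frac{D_{xy}}{L_{xy}},\qquad S_D^*=\inf_{xy\in E}\frac{D_{xy}}{L_{xy}},\qquad S=\sup_{xy\in E}\frac1{C_{xy}L_{xy}}$$ in $[0,\infty]$, a quotient with $L_{xy}=0$ being $+\infty$; neither $S_D<\infty$ nor $S_D^*>0$ is assumed. Let $$J^*=\left[i\sqrt{S_D^*},\,i\sqrt{S_D}\right]\cup\left[-i\sqrt{S_D},\,-i\sqrt{S_D^*}\right]\cup\{0\},$$ where $[i\alpha,i\beta]=\{iy: y\in\mathbb{R},\ \alpha\le y\le\beta\}$ for $\alpha,\beta\in[-\infty,\infty]$. Then $\mathbb{C}\setminus J^*$ is open, and for every $\lambda\in\mathbb{C}\setminus J^*$ all $z_{xy}^{(\lambda)}$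 are non-zero and the limit $\mathcal{P}(\lambda)=\lim_{n\to\infty}\mathcal{P}_n(\lambda)$ exists in $\mathbb{C}$; the function $\mathcal{P}$ is holomorphic in $\mathbb{C}\setminus J^*$. In particular, the same holds in the open set $\mathbb{C}\setminus[-i\sqrt S,\,i\sqrt S]$. -/

import Mathlib

open scoped NNReal ENNReal Topology

noncomputable section

/-- A graph whose edges carry a resistance `R ∈ [0, ∞)`, an inductance `L ∈ [0, ∞)` and a
capacitance `C ∈ (0, ∞]`, not all three trivial: `R + L + 1 / C > 0` on every edge.
The values of `R`, `L`, `C` on pairs that are not edges are never used. -/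
structure RLCGraph (V : Type*) where
  graph : SimpleGraph V
  R : Sym2 V → ℝ≥0
  L : Sym2 V → ℝ≥0
  C : Sym2 V → ℝ≥0∞
  C_ne_zero : ∀ e ∈ graph.edgeSet, C e ≠ 0
  pos : ∀ e ∈ graph.edgeSet, 0 < (R e : ℝ≥0∞) + L e + (C e)⁻¹

namespace RLCGraph

variable {V : Type*}

/-- The inverse capacity `D = 1 / C`, a finite number on every edge. -/
def D (N : RLCGraph V) (e : Sym2 V) : ℝ≥0 := ((N.C e)⁻¹).toNNReal

/-- The impedance `z = R + L s + D / s` of an edge, a function of the complex parameter `s`. -/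
def impedance (N : RLCGraph V) (s : ℂ) (e : Sym2 V) : ℂ :=
  ((N.R e : ℝ) : ℂ) + ((N.L e : ℝ) : ℂ) * s + ((N.D e : ℝ) : ℂ) / s

open Classical in
/-- The admittance `ρ = 1 / z` of an edge, extended by `0` to the pairs that are not edges. -/
def admittance (N : RLCGraph V) (s : ℂ) (x y : V) : ℂ :=
  if N.graph.Adj x y then 1 / N.impedance s s(x, y) else 0

/-- The set `Λ` of the parameters for which the admittance of every edge is a finite non-zero
complex number. -/
def regularSet (N : RLCGraph V) : Set ℂ :=
  {s | s ≠ 0 ∧ ∀ e ∈ N.graph.edgeSet, N.impedance s e ≠ 0}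

/-- The physical Laplacian. The sum has finitely many non-zero terms in a locally finite graph. -/
def laplacian (N : RLCGraph V) (s : ℂ) (f : V → ℂ) (x : V) : ℂ :=
  ∑ᶠ y, (f y - f x) * N.admittance s x y

/-- `v` solves the Dirichlet problem with source `a` and ground `B`. -/
structure IsVoltage (N : RLCGraph V) (a : V) (B : Set V) (s : ℂ) (v : V → ℂ) : Prop where
  harmonic : ∀ x, x ∉ B → x ≠ a → N.laplacian s v x = 0
  ground : ∀ x ∈ B, v x = 0
  source : v a = 1

open Classical in
/-- The effective admittance of the finite network with source `a` and ground `B`: the total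
current through `a` for a solution of the Dirichlet problem (its value does not depend on the
solution), and `∞` if there is no solution. It is meaningful for `s ∈ N.regularSet`. -/
def effAdmittance (N : RLCGraph V) (a : V) (B : Set V) (s : ℂ) : OnePoint ℂ :=
  if h : ∃ v, N.IsVoltage a B s v then
    ((∑ᶠ x, (1 - h.choose x) * N.admittance s x a : ℂ) : OnePoint ℂ)
  else OnePoint.infty

/-- The subgraph on a set `W` of vertices, with all the edges that have both endpoints in `W`
and the restricted weights. -/
def restrict (N : RLCGraph V) (W : Set V) : RLCGraph W where
  graph := N.graph.induce W
  R e := N.R (e.map Subtype.val)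
  L e := N.L (e.map Subtype.val)
  C e := N.C (e.map Subtype.val)
  C_ne_zero e := by
    induction e using Sym2.ind with
    | _ x y => exact fun h => N.C_ne_zero s(x.1, y.1) h
  pos e := by
    induction e using Sym2.ind with
    | _ x y => exact fun h => N.pos s(x.1, y.1) h

/-- `V_n`, the ball of radius `n` about `a` in the graph distance. -/
def ball (N : RLCGraph V) (a : V) (n : ℕ) : Set V := {x | N.graph.dist a x ≤ n}

/-- The effective admittance `P_n` of the finite network on `V_n` with source `a` and ground
`B_n = (B ∩ V_n) ∪ ∂V_n`, where `∂V_n` is the sphere of radius `n` about `a`.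
(For `n = 0` the source belongs to the ground, and the value is `∞`.) -/
def partialAdmittance (N : RLCGraph V) (a : V) (B : Set V) (n : ℕ) (s : ℂ) : OnePoint ℂ :=
  (N.restrict (N.ball a n)).effAdmittance ⟨a, by simp [ball]⟩
    {x | x.1 ∈ B ∨ N.graph.dist a x.1 = n} s

/-- The infinite network with source `a` and ground `B` (and at infinity) has the effective
admittance `p ∈ ℂ` at the parameter `s`: every `P_n(s)` is defined and `P_n(s) → p`. -/
def HasEffAdmittance (N : RLCGraph V) (a : V) (B : Set V) (s p : ℂ) : Prop :=
  s ∈ N.regularSet ∧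
    Filter.Tendsto (fun n => N.partialAdmittance a B n s) Filter.atTop (𝓝 (p : OnePoint ℂ))

/-- `S_D = sup D / L` over the edges, in `[0, ∞]`; here `D / 0 = ∞` for `D > 0`. -/
def supD (N : RLCGraph V) : ℝ≥0∞ := ⨆ e ∈ N.graph.edgeSet, (N.D e : ℝ≥0∞) / N.L e

/-- `S_D^* = inf D / L` over the edges, in `[0, ∞]`. -/
def infD (N : RLCGraph V) : ℝ≥0∞ := ⨅ e ∈ N.graph.edgeSet, (N.D e : ℝ≥0∞) / N.L e

/-- `S = sup 1 / (C L)` over the edges, in `[0, ∞]`. -/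
def supCL (N : RLCGraph V) : ℝ≥0∞ := ⨆ e ∈ N.graph.edgeSet, 1 / (N.C e * N.L e)

/-- The square root on `[0, ∞]`, as an extended real number. -/
def sqrtE (t : ℝ≥0∞) : EReal := ((t ^ (1 / 2 : ℝ) : ℝ≥0∞) : EReal)

/-- The interval `[i α, i β]` of the imaginary axis, for extended real numbers `α`, `β`. -/
def imInterval (α β : EReal) : Set ℂ :=
  {s | ∃ y : ℝ, α ≤ (y : EReal) ∧ (y : EReal) ≤ β ∧ s = Complex.I * (y : ℂ)}

/-- `J^* = [i √S_D^*, i √S_D] ∪ [-i √S_D, -i √S_D^*] ∪ {0}`. -/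
def exceptionalSet (N : RLCGraph V) : Set ℂ :=
  imInterval (sqrtE N.infD) (sqrtE N.supD) ∪ imInterval (-sqrtE N.supD) (-sqrtE N.infD) ∪ {0}

end RLCGraph

end

/-!
The potential differences along the oriented edges form a Hilbert space `ℓ²`, on which the
impedances, normalized by their values at `s = 1`, act as a bounded diagonal operator `Z(s)`
depending holomorphically on `s ≠ 0`. In a lossless network the entries of `Z(s)` lie on a compact
segment of the line through `s` and `s⁻¹`, and this segment contains `0` only if `s ∈ J^*`. Off
`J^*` a real functional separates the segment from `0`, so `Z(s)` and its inverse, the admittance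
operator, have coercive forms.

By Green's formula the voltages of the finite networks are the Galerkin solutions, in the
increasing spaces of gradients vanishing on the ground, of one variational problem for the
admittance operator. Céa's lemma makes them converge to the solution in the closed union of these
spaces, and the total current is a continuous functional of the solution. The limit solution is
obtained by inverting a compression of the admittance operator, hence is holomorphic in `s`.
-/

/-! ### Coercive forms and Galerkin solutions -/

section Coercive

open scoped InnerProductSpace

variable {𝕜 H : Type*} [RCLike 𝕜] [NormedAddCommGroup H] [InnerProductSpace 𝕜 H]

/-- The sesquilinear form `⟪x, A x⟫` is coercive in modulus, as in the Lax–Milgram theorem for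
complex forms. -/
def HasCoerciveForm (A : H →L[𝕜] H) : Prop :=
  ∃ c > 0, ∀ x, c * ‖x‖ ^ 2 ≤ ‖⟪x, A x⟫_𝕜‖

/-- The compression of an operator to a subspace. -/
noncomputable def compression (K : Submodule 𝕜 H) [K.HasOrthogonalProjection] (A : H →L[𝕜] H) :
    K →L[𝕜] K :=
  K.orthogonalProjectionOnto ∘L A ∘L K.subtypeL

theorem inner_compression (K : Submodule 𝕜 H) [K.HasOrthogonalProjection] (A : H →L[𝕜] H)
    (x y : K) : ⟪x, compression K A y⟫_𝕜 = ⟪(x : H), A y⟫_𝕜 :=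
  K.inner_orthogonalProjectionOnto_eq_of_mem_left x (A y)

namespace HasCoerciveForm

variable {A : H →L[𝕜] H}

theorem compression (hA : HasCoerciveForm A) (K : Submodule 𝕜 H) [K.HasOrthogonalProjection] :
    HasCoerciveForm (compression K A) := by
  obtain ⟨c, hc, hbound⟩ := hA
  exact ⟨c, hc, fun x => (hbound x).trans_eq (by rw [inner_compression])⟩

variable [CompleteSpace H]

theorem isUnit (hA : HasCoerciveForm A) : IsUnit A := by
  obtain ⟨c, hc, hbound⟩ := hA
  refine A.isUnit_of_forall_le_norm_inner_map (c := ⟨c, hc.le⟩) hc fun x => ?_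
  rw [norm_inner_symm, mul_comm]
  exact hbound x

theorem apply_inverse (hA : HasCoerciveForm A) (y : H) : A (Ring.inverse A y) = y :=
  DFunLike.congr_fun (Ring.mul_inverse_cancel A hA.isUnit) y

theorem inverse (hA : HasCoerciveForm A) : HasCoerciveForm (Ring.inverse A) := by
  have hinv := hA.apply_inverse
  obtain ⟨c, hc, hbound⟩ := hA
  refine ⟨c / (‖A‖ + 1) ^ 2, by positivity, fun y => ?_⟩
  set x := Ring.inverse A y
  have hy : ‖y‖ ≤ (‖A‖ + 1) * ‖x‖ := by
    rw [← hinv y]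
    exact A.le_of_opNorm_le (le_add_of_nonneg_right zero_le_one) x
  calc c / (‖A‖ + 1) ^ 2 * ‖y‖ ^ 2
      ≤ c / (‖A‖ + 1) ^ 2 * ((‖A‖ + 1) * ‖x‖) ^ 2 := by gcongr
    _ = c * ‖x‖ ^ 2 := by field_simp
    _ ≤ ‖⟪x, A x⟫_𝕜‖ := hbound x
    _ = ‖⟪y, x⟫_𝕜‖ := by rw [hinv y, norm_inner_symm]

end HasCoerciveForm

/-- `x` solves the variational problem `A x ⟂ K` in the affine space `g + K`. -/
structure IsGalerkinSolution (A : H →L[𝕜] H) (g : H) (K : Submodule 𝕜 H) (x : H) : Prop where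
  sub_mem : x - g ∈ K
  orthogonal : ∀ φ ∈ K, ⟪φ, A x⟫_𝕜 = 0

/-- The solution of the variational problem `A x ⟂ K` in `g + K`, for a coercive form. -/
noncomputable def galerkinSolution (A : H →L[𝕜] H) (g : H) (K : Submodule 𝕜 H)
    [K.HasOrthogonalProjection] : H :=
  g - (Ring.inverse (compression K A) (K.orthogonalProjectionOnto (A g)) : K)

variable {A : H →L[𝕜] H} {g : H}

theorem HasCoerciveForm.isGalerkinSolution_galerkinSolution (hA : HasCoerciveForm A)
    (K : Submodule 𝕜 H) [CompleteSpace K] :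
    IsGalerkinSolution A g K (galerkinSolution A g K) where
  sub_mem := by simp only [galerkinSolution, sub_sub_cancel_left, neg_mem_iff, SetLike.coe_mem]
  orthogonal φ hφ := by
    lift φ to K using hφ
    rw [galerkinSolution, map_sub, inner_sub_right, ← inner_compression,
      (hA.compression K).apply_inverse, K.inner_orthogonalProjectionOnto_eq_of_mem_left, sub_self]

namespace IsGalerkinSolution

variable {K K' : Submodule 𝕜 H} {x x' y : H}

/-- Céa's lemma for a form with coercivity constant `c`. -/
theorem norm_sub_le {c : ℝ} (hA : ∀ x, c * ‖x‖ ^ 2 ≤ ‖⟪x, A x⟫_𝕜‖)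
    (hx : IsGalerkinSolution A g K x) (hx' : IsGalerkinSolution A g K' x') (hK : K' ≤ K)
    (hy : y - g ∈ K') : c * ‖x' - x‖ ≤ ‖A‖ * ‖y - x‖ := by
  have galerkin_orthogonality : ∀ φ ∈ K', ⟪φ, A (x' - x)⟫_𝕜 = 0 := fun φ hφ => by
    rw [map_sub, inner_sub_right, hx'.orthogonal φ hφ, hx.orthogonal φ (hK hφ), sub_zero]
  have hyx' : y - x' ∈ K' := by simpa using K'.sub_mem hy hx'.sub_mem
  have hform : ⟪x' - x, A (x' - x)⟫_𝕜 = ⟪y - x, A (x' - x)⟫_𝕜 := by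
    rw [← sub_add_sub_cancel y x' x, inner_add_left, galerkin_orthogonality _ hyx', zero_add]
  rcases (norm_nonneg (x' - x)).eq_or_lt with h | h
  · rw [← h, mul_zero]
    positivity
  · refine le_of_mul_le_mul_right ?_ h
    calc c * ‖x' - x‖ * ‖x' - x‖ = c * ‖x' - x‖ ^ 2 := by ring
      _ ≤ ‖⟪y - x, A (x' - x)⟫_𝕜‖ := hform ▸ hA _
      _ ≤ ‖y - x‖ * (‖A‖ * ‖x' - x‖) :=
        (norm_inner_le_norm _ _).trans (by gcongr; exact A.le_opNorm _)
      _ = ‖A‖ * ‖y - x‖ * ‖x' - x‖ := by ring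

theorem unique (hA : HasCoerciveForm A) (hx : IsGalerkinSolution A g K x)
    (hx' : IsGalerkinSolution A g K x') : x' = x := by
  obtain ⟨c, hc, hbound⟩ := hA
  have h := hx.norm_sub_le hbound hx' le_rfl hx.sub_mem
  rw [sub_self, norm_zero, mul_zero] at h
  exact sub_eq_zero.1 (norm_le_zero_iff.1 (nonpos_of_mul_nonpos_right h hc))

theorem tendsto {K : ℕ → Submodule 𝕜 H} (hK : Monotone K) (hA : HasCoerciveForm A) {x : ℕ → H}
    (hx : ∀ n, IsGalerkinSolution A g (K n) (x n)) {xlim : H}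
    (hxlim : IsGalerkinSolution A g (⨆ n, K n).topologicalClosure xlim) :
    Filter.Tendsto x Filter.atTop (𝓝 xlim) := by
  obtain ⟨c, hc, hbound⟩ := hA
  rw [Metric.tendsto_atTop']
  intro ε hε
  obtain ⟨φ, hφ, hdist⟩ := Metric.mem_closure_iff.1 hxlim.sub_mem (c * ε / (‖A‖ + 1))
    (by positivity)
  obtain ⟨n₀, hn₀⟩ := (Submodule.mem_iSup_of_directed _ hK.directed_le).1 hφ
  refine ⟨n₀, fun n hn => lt_of_mul_lt_mul_left ?_ hc.le⟩
  have hcea := hxlim.norm_sub_le hbound (hx n)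
    ((le_iSup K n).trans (Submodule.le_topologicalClosure _)) (y := φ + g)
    (by simpa using hK hn.le hn₀)
  rw [dist_comm, dist_eq_norm, lt_div_iff₀ (by positivity), sub_sub_eq_add_sub] at hdist
  rw [dist_eq_norm]
  calc c * ‖x n - xlim‖ ≤ ‖A‖ * ‖φ + g - xlim‖ := hcea
    _ ≤ ‖φ + g - xlim‖ * (‖A‖ + 1) := by nlinarith [norm_nonneg (φ + g - xlim)]
    _ < c * ε := hdist

end IsGalerkinSolution

theorem differentiableAt_galerkinSolution {E : Type*} [NormedAddCommGroup E] [NormedSpace 𝕜 E]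
    {T : E → H →L[𝕜] H} {s : E} (hT : DifferentiableAt 𝕜 T s) (hA : HasCoerciveForm (T s))
    (K : Submodule 𝕜 H) [CompleteSpace K] :
    DifferentiableAt 𝕜 (fun s => galerkinSolution (T s) g K) s := by
  have hcompression : DifferentiableAt 𝕜 (fun s => compression K (T s)) s :=
    (differentiableAt_const _).clm_comp (hT.clm_comp (differentiableAt_const _))
  have hproj : DifferentiableAt 𝕜 (fun s => K.orthogonalProjectionOnto (T s g)) s :=
    K.orthogonalProjectionOnto.differentiableAt.comp s (hT.clm_apply (differentiableAt_const g))
  have hinv : DifferentiableAt 𝕜 (fun s => Ring.inverse (compression K (T s))) s :=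
    hcompression.inverse (hA.compression K).isUnit
  exact (differentiableAt_const g).sub
    (K.subtypeL.differentiableAt.comp s (hinv.clm_apply hproj))

end Coercive

/-! ### Diagonal operators on `ℓ²` -/

section Diagonal

open scoped InnerProductSpace lp

variable {𝕜 ι : Type*} [RCLike 𝕜]

/-- The diagonal operator on `ℓ²` with the bounded entries `m`. -/
noncomputable def diagonalOperator (m : ℓ^∞(ι, 𝕜)) : ℓ²(ι, 𝕜) →L[𝕜] ℓ²(ι, 𝕜) :=
  lp.holderL 2 (fun _ => ContinuousLinearMap.mul 𝕜 𝕜) (K := 1)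
    (fun _ => ContinuousLinearMap.opNorm_mul_le 𝕜 𝕜) m

theorem differentiable_diagonalOperator :
    Differentiable 𝕜 (diagonalOperator : ℓ^∞(ι, 𝕜) → ℓ²(ι, 𝕜) →L[𝕜] ℓ²(ι, 𝕜)) :=
  ContinuousLinearMap.differentiable _

@[simp]
theorem diagonalOperator_apply (m : ℓ^∞(ι, 𝕜)) (f : ℓ²(ι, 𝕜)) (i : ι) :
    diagonalOperator m f i = m i * f i :=
  rfl

theorem hasSum_inner_diagonalOperator_self (m : ℓ^∞(ι, 𝕜)) (x : ℓ²(ι, 𝕜)) :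
    HasSum (fun i => ‖x i‖ ^ 2 • m i) ⟪x, diagonalOperator m x⟫_𝕜 := by
  convert lp.hasSum_inner x (diagonalOperator m x) using 2 with i
  rw [diagonalOperator_apply, ← smul_eq_mul, inner_smul_right, inner_self_eq_norm_sq_to_K,
    RCLike.real_smul_eq_coe_mul, RCLike.ofReal_pow, mul_comm]

/-- A real functional that separates the entries from `0` bounds the form from below. -/
theorem hasCoerciveForm_diagonalOperator {m : ℓ^∞(ι, 𝕜)} {K : Set 𝕜} (hconvex : Convex ℝ K)
    (hclosed : IsClosed K) (h0 : 0 ∉ K) (hm : ∀ i, m i ∈ K) :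
    HasCoerciveForm (diagonalOperator m) := by
  obtain ⟨f, u, hu, hf⟩ := geometric_hahn_banach_point_closed hconvex hclosed h0
  rw [map_zero] at hu
  refine ⟨u / (‖f‖ + 1), by positivity, fun x => ?_⟩
  have hform : HasSum (fun i => ‖x i‖ ^ 2 * f (m i)) (f ⟪x, diagonalOperator m x⟫_𝕜) := by
    simpa only [map_smul, smul_eq_mul] using (hasSum_inner_diagonalOperator_self m x).mapL f
  have hnorm : HasSum (fun i => ‖x i‖ ^ 2 * u) (‖x‖ ^ 2 * u) := by
    simpa using (lp.hasSum_norm (p := 2) (by simp) x).mul_right u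
  have hlower : ‖x‖ ^ 2 * u ≤ f ⟪x, diagonalOperator m x⟫_𝕜 :=
    hasSum_le (fun i => by gcongr; exact (hf _ (hm i)).le) hnorm hform
  rw [div_mul_eq_mul_div, div_le_iff₀ (by positivity), mul_comm u, mul_comm ‖⟪_, _⟫_𝕜‖]
  calc ‖x‖ ^ 2 * u ≤ f ⟪x, diagonalOperator m x⟫_𝕜 := hlower
    _ ≤ ‖f ⟪x, diagonalOperator m x⟫_𝕜‖ := Real.le_norm_self _
    _ ≤ (‖f‖ + 1) * ‖⟪x, diagonalOperator m x⟫_𝕜‖ :=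
      f.le_of_opNorm_le (le_add_of_nonneg_right zero_le_one) _

theorem mul_inverse_diagonalOperator_apply {m : ℓ^∞(ι, 𝕜)}
    (hm : IsUnit (diagonalOperator m)) (f : ℓ²(ι, 𝕜)) (i : ι) :
    m i * Ring.inverse (diagonalOperator m) f i = f i :=
  congrArg (fun g : ℓ²(ι, 𝕜) => g i) (DFunLike.congr_fun (Ring.mul_inverse_cancel _ hm) f)

theorem ne_zero_of_isUnit_diagonalOperator {m : ℓ^∞(ι, 𝕜)}
    (hm : IsUnit (diagonalOperator m)) (i : ι) : m i ≠ 0 := by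
  classical
  intro h
  simpa [h] using mul_inverse_diagonalOperator_apply hm (lp.single 2 i 1) i

theorem inverse_diagonalOperator_apply {m : ℓ^∞(ι, 𝕜)}
    (hm : IsUnit (diagonalOperator m)) (f : ℓ²(ι, 𝕜)) (i : ι) :
    Ring.inverse (diagonalOperator m) f i = (m i)⁻¹ * f i := by
  rw [← mul_inverse_diagonalOperator_apply hm f i,
    inv_mul_cancel_left₀ (ne_zero_of_isUnit_diagonalOperator hm i)]

end Diagonal

namespace RLCGraph

open scoped InnerProductSpace lp

variable {V : Type*} (N : RLCGraph V)

/-! ### The impedance operator -/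

section ImpedanceOperator

theorem coe_D {e : Sym2 V} (he : e ∈ N.graph.edgeSet) : (N.D e : ℝ≥0∞) = (N.C e)⁻¹ :=
  ENNReal.coe_toNNReal (ENNReal.inv_ne_top.2 (N.C_ne_zero e he))

/-- The reference impedance of an edge, that is, its impedance at `s = 1`. It normalizes the
impedances to bounded functions on the edges. -/
noncomputable def refImpedance (e : Sym2 V) : ℝ≥0 :=
  N.R e + N.L e + N.D e

theorem refImpedance_pos {e : Sym2 V} (he : e ∈ N.graph.edgeSet) : 0 < N.refImpedance e := by
  have h := N.pos e he
  rw [← N.coe_D he] at h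
  exact_mod_cast h

theorem refImpedance_ne_zero (d : N.graph.Dart) : (N.refImpedance d.edge : ℂ) ≠ 0 := by
  exact_mod_cast (N.refImpedance_pos d.edge_mem).ne'

/-- The share `w / (R + L + D)` of one of the three weights in the reference impedance, as a
function on the oriented edges. -/
noncomputable def impedanceShare (w : Sym2 V → ℝ≥0) (hw : ∀ e, w e ≤ N.refImpedance e) :
    ℓ^∞(N.graph.Dart, ℂ) :=
  ⟨fun d => (w d.edge : ℂ) / (N.refImpedance d.edge : ℂ), memℓp_infty ⟨1, by
    rintro _ ⟨d, rfl⟩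
    simpa using div_le_one_of_le₀ (NNReal.coe_le_coe.2 (hw d.edge)) (NNReal.coe_nonneg _)⟩⟩

/-- The impedances `z(s)` of the oriented edges divided by the reference impedances `z(1)`. -/
noncomputable def normalizedImpedance (s : ℂ) : ℓ^∞(N.graph.Dart, ℂ) :=
  N.impedanceShare N.R (fun _ => by simp [refImpedance, add_assoc]) +
    s • N.impedanceShare N.L (fun _ => by simp [refImpedance, add_right_comm]) +
    s⁻¹ • N.impedanceShare N.D (fun _ => by simp [refImpedance])

theorem normalizedImpedance_apply (s : ℂ) (d : N.graph.Dart) :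
    N.normalizedImpedance s d = N.impedance s d.edge / N.refImpedance d.edge := by
  change (N.R d.edge : ℂ) / N.refImpedance d.edge + s * (N.L d.edge / N.refImpedance d.edge) +
    s⁻¹ * (N.D d.edge / N.refImpedance d.edge) = _
  rw [impedance]
  ring

/-- The multiplication by the normalized impedances. -/
noncomputable def impedanceOperator (s : ℂ) : ℓ²(N.graph.Dart, ℂ) →L[ℂ] ℓ²(N.graph.Dart, ℂ) :=
  diagonalOperator (N.normalizedImpedance s)

/-- The inverse of the impedance operator (and `0` if the impedance operator is not invertible). -/
noncomputable def admittanceOperator (s : ℂ) : ℓ²(N.graph.Dart, ℂ) →L[ℂ] ℓ²(N.graph.Dart, ℂ) :=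
  Ring.inverse (N.impedanceOperator s)

variable {N} {s : ℂ}

theorem differentiableAt_impedanceOperator (hs : s ≠ 0) :
    DifferentiableAt ℂ N.impedanceOperator s := by
  refine (differentiable_diagonalOperator _).comp s ?_
  unfold normalizedImpedance
  fun_prop (disch := assumption)

theorem differentiableAt_admittanceOperator (hs : s ≠ 0) (hz : IsUnit (N.impedanceOperator s)) :
    DifferentiableAt ℂ N.admittanceOperator s :=
  (differentiableAt_impedanceOperator hs).inverse hz

theorem impedance_ne_zero (hz : IsUnit (N.impedanceOperator s)) (d : N.graph.Dart) :
    N.impedance s d.edge ≠ 0 := by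
  have h := ne_zero_of_isUnit_diagonalOperator hz d
  rw [normalizedImpedance_apply] at h
  exact (div_ne_zero_iff.1 h).1

theorem mem_regularSet (hs : s ≠ 0) (hz : IsUnit (N.impedanceOperator s)) : s ∈ N.regularSet := by
  refine ⟨hs, fun e => ?_⟩
  induction e using Sym2.ind with
  | _ x y => exact fun he => impedance_ne_zero hz ⟨(x, y), he⟩

theorem admittanceOperator_apply (hz : IsUnit (N.impedanceOperator s))
    (f : ℓ²(N.graph.Dart, ℂ)) (d : N.graph.Dart) :
    N.admittanceOperator s f d = N.refImpedance d.edge * N.admittance s d.fst d.snd * f d := by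
  have h : N.admittance s d.fst d.snd = 1 / N.impedance s d.edge := if_pos d.adj
  rw [admittanceOperator, impedanceOperator, inverse_diagonalOperator_apply hz,
    normalizedImpedance_apply, h, inv_div, mul_one_div]

end ImpedanceOperator

/-! ### The gradient and Green's formula -/

section Gradient

theorem admittance_symm (s : ℂ) (x y : V) : N.admittance s x y = N.admittance s y x := by
  classical
  rw [admittance, admittance, Sym2.eq_swap]
  exact if_congr (N.graph.adj_comm x y) rfl rfl

theorem admittance_of_not_adj {x y : V} (h : ¬N.graph.Adj x y) (s : ℂ) :
    N.admittance s x y = 0 :=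
  if_neg h

theorem finsum_subtype_mul_admittance {W : Set V} {x : V} (hW : N.graph.neighborSet x ⊆ W)
    (s : ℂ) (F : V → ℂ) :
    ∑ᶠ y : W, F y * N.admittance s x y = ∑ᶠ y, F y * N.admittance s x y := by
  rw [finsum_set_coe_eq_finsum_mem W (f := fun y => F y * N.admittance s x y)]
  refine (finsum_mem_def _ _).trans (finsum_congr fun y => ?_)
  refine Set.indicator_apply_eq_self.2 fun hy => ?_
  rw [N.admittance_of_not_adj (fun h => hy (hW h)), mul_zero]

theorem range_dartOfNeighborSet (x : V) :
    Set.range (N.graph.dartOfNeighborSet x) = {d | d.fst = x} := by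
  ext d
  constructor
  · rintro ⟨y, rfl⟩
    rfl
  · rintro rfl
    exact ⟨⟨d.snd, d.adj⟩, rfl⟩

variable [N.graph.LocallyFinite]

theorem laplacian_eq_sum (s : ℂ) (v : V → ℂ) (x : V) :
    N.laplacian s v x = ∑ y : N.graph.neighborSet x, (v y - v x) * N.admittance s x y := by
  rw [laplacian, ← N.finsum_subtype_mul_admittance subset_rfl, finsum_eq_sum_of_fintype]

theorem finite_setOf_dart_meets (S : Finset V) :
    {d : N.graph.Dart | d.fst ∈ S ∨ d.snd ∈ S}.Finite := by
  have hfst : {d : N.graph.Dart | d.fst ∈ S}.Finite := by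
    refine (S.finite_toSet.biUnion fun x _ =>
      Set.finite_range (N.graph.dartOfNeighborSet x)).subset fun d hd => ?_
    exact Set.mem_biUnion hd ((N.range_dartOfNeighborSet d.fst).ge rfl)
  exact hfst.union (hfst.preimage SimpleGraph.Dart.symm_involutive.injective.injOn)

/-- The gradient of a finitely supported potential, as a function on the oriented edges,
normalized by the square root of the reference impedances. -/
noncomputable def gradient : (V →₀ ℂ) →ₗ[ℂ] ℓ²(N.graph.Dart, ℂ) where
  toFun v := ⟨fun d => √(N.refImpedance d.edge : ℝ)⁻¹ * (v d.fst - v d.snd), by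
    refine (memℓp_zero ((N.finite_setOf_dart_meets v.support).subset fun d hd => ?_)).of_exponent_ge
      zero_le
    by_contra! h
    simp_all⟩
  map_add' v w := by
    ext d
    simp only [Finsupp.add_apply, lp.coeFn_add, Pi.add_apply]
    ring
  map_smul' c v := by
    ext d
    simp only [Finsupp.smul_apply, smul_eq_mul, lp.coeFn_smul, Pi.smul_apply, RingHom.id_apply]
    ring

theorem gradient_apply (v : V →₀ ℂ) (d : N.graph.Dart) :
    N.gradient v d = √(N.refImpedance d.edge : ℝ)⁻¹ * (v d.fst - v d.snd) :=
  rfl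

open Classical in
theorem hasSum_ite_fst_eq (x : V) (F : N.graph.Dart → ℂ) :
    HasSum (fun d => if d.fst = x then F d else 0)
      (∑ y : N.graph.neighborSet x, F (N.graph.dartOfNeighborSet x y)) := by
  refine ((N.graph.dartOfNeighborSet_injective x).hasSum_iff fun d hd => ?_).1 ?_
  · rw [N.range_dartOfNeighborSet] at hd
    exact if_neg hd
  · convert hasSum_fintype _ using 2 with y
    exact (if_pos rfl).symm

open Classical in
theorem hasSum_ite_snd_eq (x : V) (F : N.graph.Dart → ℂ) :
    HasSum (fun d => if d.snd = x then F d else 0)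
      (∑ y : N.graph.neighborSet x, F (N.graph.dartOfNeighborSet x y).symm) :=
  (SimpleGraph.Dart.symm_involutive.toPerm).hasSum_iff.1
    (N.hasSum_ite_fst_eq x fun d => F d.symm)

variable {N} {s : ℂ}

/-- Every edge at `x` carries two darts, whence the factor `2`. -/
theorem inner_gradient_single_admittanceOperator (hz : IsUnit (N.impedanceOperator s)) (x : V)
    (v : V →₀ ℂ) :
    ⟪N.gradient (Finsupp.single x 1), N.admittanceOperator s (N.gradient v)⟫_ℂ =
      -2 * N.laplacian s v x := by
  classical
  set current : N.graph.Dart → ℂ := fun d =>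
    (v d.fst - v d.snd) * N.admittance s d.fst d.snd with hcurrent
  have hterm : ∀ d : N.graph.Dart,
      ⟪N.gradient (Finsupp.single x 1) d, N.admittanceOperator s (N.gradient v) d⟫_ℂ =
        (if d.fst = x then current d else 0) - (if d.snd = x then current d else 0) := fun d => by
    have hsqrt : ((√(N.refImpedance d.edge : ℝ)⁻¹ : ℝ) : ℂ) ^ 2 * N.refImpedance d.edge = 1 := by
      rw [← Complex.ofReal_pow, Real.sq_sqrt (by positivity), Complex.ofReal_inv]
      exact inv_mul_cancel₀ (N.refImpedance_ne_zero d)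
    rw [admittanceOperator_apply hz, gradient_apply, gradient_apply, ← boole_mul _ (current d),
      ← boole_mul _ (current d)]
    simp only [hcurrent, Finsupp.single_apply, RCLike.inner_apply, map_mul, Complex.conj_ofReal,
      map_sub, apply_ite (starRingEnd ℂ), map_one, map_zero, eq_comm (a := x)]
    linear_combination ((if d.fst = x then 1 else 0) - if d.snd = x then 1 else 0) *
      ((v d.fst - v d.snd) * N.admittance s d.fst d.snd) * hsqrt
  rw [(lp.hasSum_inner _ _).unique
    (((N.hasSum_ite_fst_eq x current).sub (N.hasSum_ite_snd_eq x current)).congr_fun hterm),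
    laplacian_eq_sum, ← Finset.sum_sub_distrib, Finset.mul_sum]
  refine Finset.sum_congr rfl fun y _ => ?_
  change (v x - v y) * N.admittance s x y - (v y - v x) * N.admittance s y x = _
  rw [N.admittance_symm s y x]
  ring

end Gradient

/-! ### Voltages as Galerkin solutions -/

section DirichletSpace

variable {a : V} {G : Set V} {s : ℂ}

variable [N.graph.LocallyFinite]

/-- The gradients of the finitely supported potentials which vanish at the source and on the
ground. -/
noncomputable def dirichletSpace (a : V) (G : Set V) : Submodule ℂ ℓ²(N.graph.Dart, ℂ) :=
  (Finsupp.supported ℂ ℂ (insert a G)ᶜ).map N.gradient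

theorem dirichletSpace_anti (a : V) : Antitone (N.dirichletSpace a) := fun _ _ h =>
  Submodule.map_mono <| Finsupp.supported_mono <| Set.compl_subset_compl.2 <|
    Set.insert_subset_insert h

theorem dirichletSpace_eq_span (a : V) (G : Set V) :
    N.dirichletSpace a G =
      Submodule.span ℂ ((fun x => N.gradient (Finsupp.single x 1)) '' (insert a G)ᶜ) := by
  rw [dirichletSpace, Finsupp.supported_eq_span_single, Submodule.map_span, Set.image_image]

theorem finiteDimensional_dirichletSpace (a : V) (hG : Gᶜ.Finite) :
    FiniteDimensional ℂ (N.dirichletSpace a G) := by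
  rw [dirichletSpace_eq_span]
  exact FiniteDimensional.span_of_finite ℂ
    ((hG.subset (Set.compl_subset_compl.2 (Set.subset_insert a G))).image _)

variable {N}

theorem forall_inner_admittanceOperator_eq_zero_iff (hz : IsUnit (N.impedanceOperator s))
    (v : V →₀ ℂ) :
    (∀ φ ∈ N.dirichletSpace a G, ⟪φ, N.admittanceOperator s (N.gradient v)⟫_ℂ = 0) ↔
      ∀ x, x ∉ G → x ≠ a → N.laplacian s v x = 0 := by
  have h : N.dirichletSpace a G ≤ (ℂ ∙ N.admittanceOperator s (N.gradient v))ᗮ ↔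
      ∀ x ∈ (insert a G)ᶜ, N.laplacian s v x = 0 := by
    rw [dirichletSpace_eq_span, Submodule.span_le, Set.image_subset_iff]
    refine forall₂_congr fun x _ => ?_
    rw [Set.mem_preimage, SetLike.mem_coe, Submodule.mem_orthogonal_singleton_iff_inner_left,
      inner_gradient_single_admittanceOperator hz]
    simp
  simp only [SetLike.le_def, Submodule.mem_orthogonal_singleton_iff_inner_left] at h
  rw [h]
  simp only [Set.mem_compl_iff, Set.mem_insert_iff, not_or, and_imp]
  exact forall_congr' fun x => forall_comm

theorem isGalerkinSolution_gradient (hz : IsUnit (N.impedanceOperator s)) (ha : a ∉ G)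
    {v : V →₀ ℂ} (hv : N.IsVoltage a G s v) :
    IsGalerkinSolution (N.admittanceOperator s) (N.gradient (Finsupp.single a 1))
      (N.dirichletSpace a G) (N.gradient v) where
  sub_mem := by
    rw [← map_sub]
    refine Submodule.mem_map_of_mem ((Finsupp.mem_supported' ℂ _).2 fun x hx => ?_)
    rw [Set.notMem_compl_iff, Set.mem_insert_iff] at hx
    rcases hx with rfl | hx
    · simp [hv.source]
    · have : a ≠ x := fun h => ha (h ▸ hx)
      simp [hv.ground x hx, this]
  orthogonal := (forall_inner_admittanceOperator_eq_zero_iff hz v).2 hv.harmonic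

theorem exists_isVoltage_of_isGalerkinSolution (hz : IsUnit (N.impedanceOperator s)) (ha : a ∉ G)
    {x : ℓ²(N.graph.Dart, ℂ)}
    (hx : IsGalerkinSolution (N.admittanceOperator s) (N.gradient (Finsupp.single a 1))
      (N.dirichletSpace a G) x) :
    ∃ v : V →₀ ℂ, N.IsVoltage a G s v := by
  obtain ⟨φ, hφ, hφx⟩ := hx.sub_mem
  have hzero : ∀ y ∈ insert a G, φ y = 0 := fun y hy =>
    (Finsupp.mem_supported' ℂ φ).1 hφ y (Set.notMem_compl_iff.2 hy)
  have hgrad : N.gradient (φ + Finsupp.single a 1) = x := by rw [map_add, hφx, sub_add_cancel]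
  refine ⟨φ + Finsupp.single a 1, ?_, fun y hy => ?_, ?_⟩
  · exact (forall_inner_admittanceOperator_eq_zero_iff hz _).1 (hgrad ▸ hx.orthogonal)
  · have : a ≠ y := fun h => ha (h ▸ hy)
    simp [hzero y (.inr hy), this]
  · simp [hzero a (.inl rfl)]

theorem IsVoltage.current_eq (hz : HasCoerciveForm (N.impedanceOperator s)) (ha : a ∉ G)
    (hG : Gᶜ.Finite) {v : V → ℂ} (hv : N.IsVoltage a G s v) {x : ℓ²(N.graph.Dart, ℂ)}
    (hx : IsGalerkinSolution (N.admittanceOperator s) (N.gradient (Finsupp.single a 1))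
      (N.dirichletSpace a G) x) :
    ∑ᶠ y, (1 - v y) * N.admittance s y a =
      2⁻¹ * ⟪N.gradient (Finsupp.single a 1), N.admittanceOperator s x⟫_ℂ := by
  lift v to V →₀ ℂ using hG.subset fun x hx hxG => hx (hv.ground x hxG)
  rw [← hx.unique hz.inverse (isGalerkinSolution_gradient hz.isUnit ha hv),
    inner_gradient_single_admittanceOperator hz.isUnit, laplacian, hv.source, neg_mul, mul_neg,
    inv_mul_cancel_left₀ two_ne_zero, ← finsum_neg_distrib]
  refine finsum_congr fun y => ?_
  rw [N.admittance_symm s y a, ← neg_mul, neg_sub]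

end DirichletSpace

/-! ### Finite networks -/

section FiniteNetwork

variable {W : Set V} {a : V} {G : Set V} {s : ℂ}

theorem laplacian_restrict {x : W} (hW : N.graph.neighborSet x ⊆ W) (s : ℂ) (v : V → ℂ) :
    (N.restrict W).laplacian s (fun y => v y) x = N.laplacian s v x :=
  N.finsum_subtype_mul_admittance hW s fun y => v y - v x

variable {N}

theorem isVoltage_restrict_iff (ha : a ∈ W) (hG : ∀ x ∉ G, x ∈ W ∧ N.graph.neighborSet x ⊆ W)
    {v : V → ℂ} (hv : ∀ x ∉ W, v x = 0) :
    (N.restrict W).IsVoltage ⟨a, ha⟩ (Subtype.val ⁻¹' G) s (fun x => v x) ↔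
      N.IsVoltage a G s v := by
  constructor
  · intro h
    refine ⟨fun x hx hxa => ?_, fun x hx => ?_, h.source⟩
    · rw [← N.laplacian_restrict (x := ⟨x, (hG x hx).1⟩) (hG x hx).2]
      exact h.harmonic _ hx fun h => hxa (congrArg Subtype.val h)
    · by_cases hxW : x ∈ W
      · exact h.ground ⟨x, hxW⟩ hx
      · exact hv x hxW
  · intro h
    refine ⟨fun x hx hxa => ?_, fun x hx => h.ground x hx, h.source⟩
    rw [N.laplacian_restrict (hG x hx).2]
    exact h.harmonic x hx fun h => hxa (Subtype.ext h)

theorem effAdmittance_eq {a : V} {p : ℂ} (hex : ∃ v, N.IsVoltage a G s v)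
    (hp : ∀ v, N.IsVoltage a G s v → ∑ᶠ x, (1 - v x) * N.admittance s x a = p) :
    N.effAdmittance a G s = p := by
  rw [effAdmittance, dif_pos hex, hp _ hex.choose_spec]

theorem effAdmittance_restrict_eq [N.graph.LocallyFinite]
    (hz : HasCoerciveForm (N.impedanceOperator s)) (ha : a ∉ G)
    (hfin : Gᶜ.Finite) (hG : ∀ x ∉ G, x ∈ W ∧ N.graph.neighborSet x ⊆ W)
    {x : ℓ²(N.graph.Dart, ℂ)}
    (hx : IsGalerkinSolution (N.admittanceOperator s) (N.gradient (Finsupp.single a 1))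
      (N.dirichletSpace a G) x) :
    (N.restrict W).effAdmittance ⟨a, (hG a ha).1⟩ (Subtype.val ⁻¹' G) s =
      (2⁻¹ * ⟪N.gradient (Finsupp.single a 1), N.admittanceOperator s x⟫_ℂ : ℂ) := by
  have hvW : ∀ x ∉ W, x ∈ G := fun x hx => by_contra fun h => hx (hG x h).1
  apply effAdmittance_eq
  · obtain ⟨v, hv⟩ := exists_isVoltage_of_isGalerkinSolution hz.isUnit ha hx
    exact ⟨_, (isVoltage_restrict_iff _ hG fun x hx => hv.ground x (hvW x hx)).2 hv⟩
  · intro u hu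
    set v : V → ℂ := Function.extend Subtype.val u 0
    have hvu : (fun x : W => v x) = u := Function.extend_comp Subtype.val_injective u 0
    rw [← hvu] at hu ⊢
    have hv0 : ∀ x ∉ W, v x = 0 := fun x hx =>
      Function.extend_apply' _ _ _ (by rintro ⟨y, rfl⟩; exact hx y.2)
    have hv : N.IsVoltage a G s v := (isVoltage_restrict_iff _ hG hv0).1 hu
    rw [← hv.current_eq hz ha hfin hx]
    simp only [N.admittance_symm s _ a, (N.restrict W).admittance_symm s _ ⟨a, _⟩]
    exact N.finsum_subtype_mul_admittance (hG a ha).2 s fun y => 1 - v y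

end FiniteNetwork

/-! ### Balls and the limit -/

section Limit

variable {a : V} {B : Set V} {n : ℕ}

theorem neighborSet_subset_ball (hconn : N.graph.Connected) {x : V}
    (hx : N.graph.dist a x < n) : N.graph.neighborSet x ⊆ N.ball a n := fun y hy => by
  calc N.graph.dist a y ≤ N.graph.dist a x + N.graph.dist x y := hconn.dist_triangle
    _ ≤ n := by rwa [SimpleGraph.dist_eq_one_iff_adj.2 hy, Nat.add_one_le_iff]

/-- The ground `B` enlarged by everything outside the open ball of radius `n` about `a`. Its trace
on `V_n` is the ground `B_n` of the finite network; the vertices outside `V_n` are grounded so that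
all finite networks can be compared on `V`. -/
def truncatedGround (a : V) (B : Set V) (n : ℕ) : Set V :=
  B ∪ {x | n ≤ N.graph.dist a x}

theorem truncatedGround_anti (a : V) (B : Set V) : Antitone (N.truncatedGround a B) := fun _ _ h =>
  Set.union_subset_union_right B fun _ => h.trans

theorem notMem_truncatedGround {x : V} :
    x ∉ N.truncatedGround a B n ↔ x ∉ B ∧ N.graph.dist a x < n := by
  simp [truncatedGround]

theorem preimage_truncatedGround (a : V) (B : Set V) (n : ℕ) :
    (Subtype.val ⁻¹' N.truncatedGround a B n : Set (N.ball a n)) =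
      {x | x.1 ∈ B ∨ N.graph.dist a x.1 = n} :=
  Set.ext fun x => or_congr_right (LE.le.ge_iff_eq (show N.graph.dist a x ≤ n from x.2))

variable [N.graph.LocallyFinite]

theorem finite_ball (hconn : N.graph.Connected) (a : V) (n : ℕ) : (N.ball a n).Finite := by
  induction n generalizing a with
  | zero =>
    refine (Set.finite_singleton a).subset fun x hx => ?_
    exact (hconn.dist_eq_zero_iff.1 (Nat.le_zero.1 hx)).symm
  | succ n ih =>
    refine ((Set.finite_singleton a).union
      ((N.graph.neighborSet a).toFinite.biUnion fun b _ => ih b)).subset fun x hx => ?_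
    obtain ⟨p, hp⟩ := hconn.exists_walk_length_eq_dist a x
    replace hx : p.length ≤ n + 1 := hp.trans_le hx
    cases p with
    | nil => exact .inl rfl
    | cons hadj q =>
      exact .inr (Set.mem_biUnion hadj ((SimpleGraph.dist_le q).trans (Nat.le_of_succ_le_succ hx)))

theorem finite_compl_truncatedGround (hconn : N.graph.Connected) (a : V) (B : Set V) (n : ℕ) :
    (N.truncatedGround a B n)ᶜ.Finite :=
  (N.finite_ball hconn a n).subset fun _ hx => (N.notMem_truncatedGround.1 hx).2.le

/-- The effective admittance of the infinite network, read off from the variational problem on the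
closure of the Dirichlet spaces of all the balls. -/
noncomputable def limitAdmittance (a : V) (B : Set V) (s : ℂ) : ℂ :=
  2⁻¹ * ⟪N.gradient (Finsupp.single a 1), N.admittanceOperator s
    (galerkinSolution (N.admittanceOperator s) (N.gradient (Finsupp.single a 1))
      (⨆ n, N.dirichletSpace a (N.truncatedGround a B n)).topologicalClosure)⟫_ℂ

variable {N} {s : ℂ}

theorem partialAdmittance_eq (hconn : N.graph.Connected)
    (hz : HasCoerciveForm (N.impedanceOperator s)) (ha : a ∉ B) (hn : 0 < n)
    {x : ℓ²(N.graph.Dart, ℂ)}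
    (hx : IsGalerkinSolution (N.admittanceOperator s) (N.gradient (Finsupp.single a 1))
      (N.dirichletSpace a (N.truncatedGround a B n)) x) :
    N.partialAdmittance a B n s =
      (2⁻¹ * ⟪N.gradient (Finsupp.single a 1), N.admittanceOperator s x⟫_ℂ : ℂ) := by
  rw [partialAdmittance, ← preimage_truncatedGround]
  refine effAdmittance_restrict_eq hz ?_ (N.finite_compl_truncatedGround hconn a B n)
    (fun y hy => ?_) hx
  · simpa [notMem_truncatedGround] using ⟨ha, hn⟩
  · have hdist := (N.notMem_truncatedGround.1 hy).2
    exact ⟨hdist.le, N.neighborSet_subset_ball hconn hdist⟩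

theorem hasEffAdmittance_limitAdmittance (hconn : N.graph.Connected) (ha : a ∉ B) (hs : s ≠ 0)
    (hz : HasCoerciveForm (N.impedanceOperator s)) :
    N.HasEffAdmittance a B s (N.limitAdmittance a B s) := by
  refine ⟨mem_regularSet hs hz.isUnit, ?_⟩
  have hexists : ∀ n, ∃ x, IsGalerkinSolution (N.admittanceOperator s)
      (N.gradient (Finsupp.single a 1)) (N.dirichletSpace a (N.truncatedGround a B n)) x := by
    intro n
    have := N.finiteDimensional_dirichletSpace a (N.finite_compl_truncatedGround hconn a B n)
    have := FiniteDimensional.complete ℂ (N.dirichletSpace a (N.truncatedGround a B n))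
    exact ⟨_, hz.inverse.isGalerkinSolution_galerkinSolution _⟩
  choose x hx using hexists
  have hlim := IsGalerkinSolution.tendsto
    ((N.dirichletSpace_anti a).comp (N.truncatedGround_anti a B)) hz.inverse hx
    (hz.inverse.isGalerkinSolution_galerkinSolution _)
  have hcurrent : Continuous fun x => (2⁻¹ * ⟪N.gradient (Finsupp.single a 1),
      N.admittanceOperator s x⟫_ℂ : ℂ) := by fun_prop
  refine ((OnePoint.continuous_coe.comp hcurrent).tendsto _ |>.comp hlim).congr' ?_
  filter_upwards [Filter.eventually_gt_atTop 0] with n hn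
  exact (partialAdmittance_eq hconn hz ha hn (hx n)).symm

theorem differentiableAt_limitAdmittance (hs : s ≠ 0)
    (hz : HasCoerciveForm (N.impedanceOperator s)) :
    DifferentiableAt ℂ (N.limitAdmittance a B) s := by
  have hadmittance := differentiableAt_admittanceOperator hs hz.isUnit
  have hsolution := differentiableAt_galerkinSolution (g := N.gradient (Finsupp.single a 1))
    hadmittance hz.inverse
    (⨆ n, N.dirichletSpace a (N.truncatedGround a B n)).topologicalClosure
  exact ((innerSL ℂ (N.gradient (Finsupp.single a 1))).differentiableAt.comp s
    (hadmittance.clm_apply hsolution)).const_mul 2⁻¹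

end Limit

/-! ### Lossless networks -/

section Lossless

theorem mem_imInterval {α β : EReal} {s : ℂ} :
    s ∈ imInterval α β ↔ s.re = 0 ∧ α ≤ (s.im : EReal) ∧ (s.im : EReal) ≤ β := by
  constructor
  · rintro ⟨y, hα, hβ, rfl⟩
    simpa using ⟨hα, hβ⟩
  · rintro ⟨hre, hα, hβ⟩
    exact ⟨s.im, hα, hβ, Complex.ext (by simp [hre]) (by simp)⟩

theorem neg_mem_imInterval {α β : EReal} {s : ℂ} :
    -s ∈ imInterval α β ↔ s ∈ imInterval (-β) (-α) := by
  simp only [mem_imInterval, Complex.neg_re, Complex.neg_im, neg_eq_zero, EReal.coe_neg,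
    EReal.le_neg, EReal.neg_le]
  rw [and_comm (a := _ ≤ -α)]

theorem isClosed_imInterval (α β : EReal) : IsClosed (imInterval α β) := by
  have hpreimage : imInterval α β = Complex.re ⁻¹' {0} ∩
      (fun s : ℂ => (s.im : EReal)) ⁻¹' Set.Icc α β := Set.ext fun _ => mem_imInterval
  rw [hpreimage]
  exact (isClosed_singleton.preimage Complex.continuous_re).inter
    (isClosed_Icc.preimage (continuous_coe_real_ereal.comp Complex.continuous_im))

theorem isClosed_exceptionalSet : IsClosed N.exceptionalSet :=
  ((isClosed_imInterval _ _).union (isClosed_imInterval _ _)).union isClosed_singleton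

theorem sqrtE_nonneg (t : ℝ≥0∞) : 0 ≤ sqrtE t :=
  EReal.coe_ennreal_nonneg _

theorem abs_le_sqrtE {y : ℝ} {t : ℝ≥0∞} : ((|y| : ℝ) : EReal) ≤ sqrtE t ↔ ‖y‖ₑ ^ 2 ≤ t := by
  rw [sqrtE, ← Real.norm_eq_abs, ← coe_nnnorm, ← EReal.coe_nnreal_eq_coe_real,
    EReal.coe_ennreal_le_coe_ennreal_iff, one_div, ENNReal.le_rpow_inv_iff two_pos,
    ENNReal.rpow_two, enorm_eq_nnnorm]

theorem sqrtE_le_abs {y : ℝ} {t : ℝ≥0∞} : sqrtE t ≤ ((|y| : ℝ) : EReal) ↔ t ≤ ‖y‖ₑ ^ 2 := by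
  rw [sqrtE, ← Real.norm_eq_abs, ← coe_nnnorm, ← EReal.coe_nnreal_eq_coe_real,
    EReal.coe_ennreal_le_coe_ennreal_iff, one_div, ENNReal.rpow_inv_le_iff two_pos,
    ENNReal.rpow_two, enorm_eq_nnnorm]

theorem mem_imInterval_sqrtE {t u : ℝ≥0∞} {s : ℂ} :
    s ∈ imInterval (sqrtE t) (sqrtE u) ↔
      s.re = 0 ∧ 0 ≤ s.im ∧ t ≤ ‖s.im‖ₑ ^ 2 ∧ ‖s.im‖ₑ ^ 2 ≤ u := by
  rw [mem_imInterval, ← abs_le_sqrtE, ← sqrtE_le_abs]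
  refine and_congr_right fun _ => ⟨fun h => ?_, fun ⟨him, h⟩ => by rwa [abs_of_nonneg him] at h⟩
  have him : 0 ≤ s.im := EReal.coe_nonneg.1 ((sqrtE_nonneg t).trans h.1)
  exact ⟨him, by rwa [abs_of_nonneg him]⟩

theorem mem_imInterval_neg_sqrtE {t : ℝ≥0∞} {s : ℂ} (hre : s.re = 0) (ht : ‖s.im‖ₑ ^ 2 ≤ t) :
    s ∈ imInterval (-sqrtE t) (sqrtE t) := by
  have habs := abs_le_sqrtE.2 ht
  refine mem_imInterval.2 ⟨hre, ?_, le_trans (mod_cast le_abs_self s.im) habs⟩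
  refine (EReal.neg_le_neg_iff.2 habs).trans ?_
  exact_mod_cast neg_abs_le s.im

variable {N} {s : ℂ}

theorem mem_exceptionalSet_iff : s ∈ N.exceptionalSet ↔
    s = 0 ∨ s.re = 0 ∧ N.infD ≤ ‖s.im‖ₑ ^ 2 ∧ ‖s.im‖ₑ ^ 2 ≤ N.supD := by
  rw [exceptionalSet, Set.mem_union, Set.mem_union, ← neg_mem_imInterval, mem_imInterval_sqrtE,
    mem_imInterval_sqrtE, Complex.neg_re, Complex.neg_im, enorm_neg, neg_eq_zero, neg_nonneg,
    Set.mem_singleton_iff]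
  have := le_total 0 s.im
  tauto

theorem refImpedance_eq_add (hR : ∀ e ∈ N.graph.edgeSet, N.R e = 0) {e : Sym2 V}
    (he : e ∈ N.graph.edgeSet) : N.refImpedance e = N.L e + N.D e := by
  rw [refImpedance, hR e he, zero_add]

theorem supD_le_supCL (hR : ∀ e ∈ N.graph.edgeSet, N.R e = 0) : N.supD ≤ N.supCL := by
  refine iSup₂_mono fun e he => ?_
  have htop : N.C e ≠ ⊤ ∨ (N.L e : ℝ≥0∞) ≠ 0 := by
    have hpos := N.refImpedance_pos he
    rw [N.refImpedance_eq_add hR he] at hpos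
    by_contra! h
    simp [D, h.1, ENNReal.coe_eq_zero.1 h.2] at hpos
  rw [N.coe_D he, one_div, ENNReal.mul_inv (.inl (N.C_ne_zero e he)) htop, div_eq_mul_inv]

theorem exceptionalSet_subset (hR : ∀ e ∈ N.graph.edgeSet, N.R e = 0) :
    N.exceptionalSet ⊆ imInterval (-sqrtE N.supCL) (sqrtE N.supCL) := fun s hs => by
  rcases mem_exceptionalSet_iff.1 hs with rfl | ⟨hre, -, him⟩
  · exact mem_imInterval_neg_sqrtE rfl (by simp)
  · exact mem_imInterval_neg_sqrtE hre (him.trans (supD_le_supCL hR))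

/-- For `L = 0` both sides are `0`, since then `D / 0 = ∞`. -/
theorem coe_L_div_refImpedance (hR : ∀ e ∈ N.graph.edgeSet, N.R e = 0) {e : Sym2 V}
    (he : e ∈ N.graph.edgeSet) :
    ((N.L e / N.refImpedance e : ℝ≥0) : ℝ≥0∞) = (1 + (N.D e : ℝ≥0∞) / N.L e)⁻¹ := by
  have hpos := N.refImpedance_pos he
  rw [ENNReal.coe_div hpos.ne', refImpedance_eq_add hR he]
  rw [refImpedance_eq_add hR he] at hpos
  rcases eq_or_ne (N.L e) 0 with hL | hL
  · rw [hL, zero_add] at hpos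
    simp [hL, ENNReal.div_zero, hpos.ne']
  · have hL' : (N.L e : ℝ≥0∞) ≠ 0 := ENNReal.coe_ne_zero.2 hL
    rw [← ENNReal.div_self hL' ENNReal.coe_ne_top, ENNReal.div_add_div_same,
      ENNReal.inv_div (.inl ENNReal.coe_ne_top) (.inl hL'), ENNReal.coe_add]

theorem normalizedImpedance_eq_lineMap (hR : ∀ e ∈ N.graph.edgeSet, N.R e = 0) (s : ℂ)
    (d : N.graph.Dart) :
    N.normalizedImpedance s d =
      AffineMap.lineMap s⁻¹ s ((N.L d.edge / N.refImpedance d.edge : ℝ≥0) : ℝ) := by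
  have href := N.refImpedance_ne_zero d
  have hadd : (N.refImpedance d.edge : ℂ) = N.L d.edge + N.D d.edge := by
    exact_mod_cast refImpedance_eq_add hR d.edge_mem
  rw [normalizedImpedance_apply, impedance, hR _ d.edge_mem, AffineMap.lineMap_apply_module]
  simp only [Complex.real_smul]
  push_cast
  rw [one_sub_div href, hadd, add_sub_cancel_left]
  ring

theorem ofReal_eq_inv_of_lineMap_inv_eq_zero (hs : s ≠ 0) {τ : ℝ} (hτ : τ ∈ Set.Icc (0 : ℝ) 1)
    (h : AffineMap.lineMap s⁻¹ s τ = 0) :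
    s.re = 0 ∧ ENNReal.ofReal τ = (1 + ‖s.im‖ₑ ^ 2)⁻¹ := by
  have hquad : (τ : ℂ) * s ^ 2 + (1 - τ) = 0 := by
    rw [AffineMap.lineMap_apply_module, Complex.real_smul, Complex.real_smul] at h
    push_cast at h
    field_simp at h
    linear_combination h
  have hre : τ * (s.re ^ 2 - s.im ^ 2) + (1 - τ) = 0 := by
    simpa [sq] using congrArg Complex.re hquad
  have him : τ * (s.re * s.im) = 0 := by
    simpa [sq, mul_comm s.im, ← two_mul] using congrArg Complex.im hquad
  have hτ0 : 0 < τ := hτ.1.lt_of_ne (by rintro rfl; simp at hre)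
  have hre0 : s.re = 0 := by
    rcases mul_eq_zero.1 ((mul_eq_zero.1 him).resolve_left hτ0.ne') with h0 | h0
    · exact h0
    · rw [h0] at hre
      nlinarith [hτ.2, mul_nonneg hτ.1 (sq_nonneg s.re)]
  refine ⟨hre0, ENNReal.eq_inv_of_mul_eq_one_left ?_⟩
  rw [Real.enorm_eq_ofReal_abs, ← ENNReal.ofReal_pow (abs_nonneg _), sq_abs, ← ENNReal.ofReal_one,
    ← ENNReal.ofReal_add zero_le_one (sq_nonneg _), ← ENNReal.ofReal_mul hτ.1]
  rw [hre0] at hre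
  congr 1
  linarith

theorem coe_L_div_refImpedance_mem_Icc (hR : ∀ e ∈ N.graph.edgeSet, N.R e = 0) {e : Sym2 V}
    (he : e ∈ N.graph.edgeSet) :
    ((N.L e / N.refImpedance e : ℝ≥0) : ℝ) ∈
      Set.Icc (1 + N.supD)⁻¹.toReal (1 + N.infD)⁻¹.toReal := by
  have hshare := coe_L_div_refImpedance hR he
  have hsup : (N.D e : ℝ≥0∞) / N.L e ≤ N.supD :=
    le_iSup₂ (f := fun e (_ : e ∈ N.graph.edgeSet) => (N.D e : ℝ≥0∞) / N.L e) e he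
  have hinf : N.infD ≤ (N.D e : ℝ≥0∞) / N.L e := iInf₂_le e he
  constructor
  · refine ENNReal.toReal_mono ENNReal.coe_ne_top (hshare.ge.trans' ?_)
    gcongr
  · refine ENNReal.toReal_mono (by simp) (hshare.le.trans ?_)
    gcongr

theorem hasCoerciveForm_impedanceOperator (hR : ∀ e ∈ N.graph.edgeSet, N.R e = 0)
    (hs : s ∉ N.exceptionalSet) : HasCoerciveForm (N.impedanceOperator s) := by
  set segment : Set ℂ :=
    AffineMap.lineMap s⁻¹ s '' Set.Icc (1 + N.supD)⁻¹.toReal (1 + N.infD)⁻¹.toReal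
  have hconvex : Convex ℝ segment := (convex_Icc _ _).affine_image _
  have hclosed : IsClosed segment :=
    (isCompact_Icc.image AffineMap.lineMap_continuous).isClosed
  refine hasCoerciveForm_diagonalOperator hconvex hclosed ?_ fun d => ?_
  · rintro ⟨τ, ⟨hsup, hinf⟩, hτ⟩
    rw [mem_exceptionalSet_iff, not_or] at hs
    have hτ0 : 0 ≤ τ := ENNReal.toReal_nonneg.trans hsup
    have hτ1 : τ ≤ 1 :=
      hinf.trans (ENNReal.toReal_mono ENNReal.one_ne_top (ENNReal.inv_le_one.2 le_self_add))
    obtain ⟨hre, hofReal⟩ := ofReal_eq_inv_of_lineMap_inv_eq_zero hs.1 ⟨hτ0, hτ1⟩ hτ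
    rw [← ENNReal.le_ofReal_iff_toReal_le (by simp) hτ0, hofReal, ENNReal.inv_le_inv] at hsup
    rw [← ENNReal.ofReal_le_iff_le_toReal (by simp), hofReal, ENNReal.inv_le_inv] at hinf
    exact hs.2 ⟨hre, (ENNReal.add_le_add_iff_left ENNReal.one_ne_top).1 hinf,
      (ENNReal.add_le_add_iff_left ENNReal.one_ne_top).1 hsup⟩
  · rw [normalizedImpedance_eq_lineMap hR]
    exact Set.mem_image_of_mem _ (coe_L_div_refImpedance_mem_Icc hR d.edge_mem)

end Lossless

end RLCGraph

theorem mainTheorem2_general {V : Type*} (N : RLCGraph V)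
    (hconn : N.graph.Connected) (hfin : ∀ x, (N.graph.neighborSet x).Finite)
    (a : V) (B : Set V) (ha : a ∉ B)
    (hR : ∀ e ∈ N.graph.edgeSet, N.R e = 0) :
    ∃ P : ℂ → ℂ,
      (IsOpen (N.exceptionalSet)ᶜ ∧
        (∀ s ∈ (N.exceptionalSet)ᶜ, N.HasEffAdmittance a B s (P s)) ∧
        DifferentiableOn ℂ P (N.exceptionalSet)ᶜ) ∧
      (IsOpen (RLCGraph.imInterval (-RLCGraph.sqrtE N.supCL) (RLCGraph.sqrtE N.supCL))ᶜ ∧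
        (∀ s ∈ (RLCGraph.imInterval (-RLCGraph.sqrtE N.supCL) (RLCGraph.sqrtE N.supCL))ᶜ,
          N.HasEffAdmittance a B s (P s)) ∧
        DifferentiableOn ℂ P
          (RLCGraph.imInterval (-RLCGraph.sqrtE N.supCL) (RLCGraph.sqrtE N.supCL))ᶜ) := by
  let _ : N.graph.LocallyFinite := fun x => (hfin x).fintype
  have hne : ∀ s ∈ (N.exceptionalSet)ᶜ, s ≠ 0 := fun s hs h => hs (.inr h)
  have hcoercive : ∀ s ∈ (N.exceptionalSet)ᶜ, HasCoerciveForm (N.impedanceOperator s) :=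
    fun s => RLCGraph.hasCoerciveForm_impedanceOperator hR
  have hlim : ∀ s ∈ (N.exceptionalSet)ᶜ, N.HasEffAdmittance a B s (N.limitAdmittance a B s) :=
    fun s hs => RLCGraph.hasEffAdmittance_limitAdmittance hconn ha (hne s hs) (hcoercive s hs)
  have hdiff : DifferentiableOn ℂ (N.limitAdmittance a B) (N.exceptionalSet)ᶜ := fun s hs =>
    (RLCGraph.differentiableAt_limitAdmittance (hne s hs)
      (hcoercive s hs)).differentiableWithinAt
  have hsubset := Set.compl_subset_compl.2 (RLCGraph.exceptionalSet_subset hR)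
  exact ⟨N.limitAdmittance a B,
    ⟨N.isClosed_exceptionalSet.isOpen_compl, hlim, hdiff⟩,
    ⟨(RLCGraph.isClosed_imInterval _ _).isOpen_compl, fun s hs => hlim s (hsubset hs),
      hdiff.mono hsubset⟩⟩

theorem mainTheorem2 {V : Type*} [Infinite V] (N : RLCGraph V)
    (hconn : N.graph.Connected) (hfin : ∀ x, (N.graph.neighborSet x).Finite)
    (a : V) (B : Set V) (ha : a ∉ B)
    (hR : ∀ e ∈ N.graph.edgeSet, N.R e = 0) :
    ∃ P : ℂ → ℂ,
      (IsOpen (N.exceptionalSet)ᶜ ∧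
        (∀ s ∈ (N.exceptionalSet)ᶜ, N.HasEffAdmittance a B s (P s)) ∧
        DifferentiableOn ℂ P (N.exceptionalSet)ᶜ) ∧
      (IsOpen (RLCGraph.imInterval (-RLCGraph.sqrtE N.supCL) (RLCGraph.sqrtE N.supCL))ᶜ ∧
        (∀ s ∈ (RLCGraph.imInterval (-RLCGraph.sqrtE N.supCL) (RLCGraph.sqrtE N.supCL))ᶜ,
          N.HasEffAdmittance a B s (P s)) ∧
        DifferentiableOn ℂ P
          (RLCGraph.imInterval (-RLCGraph.sqrtE N.supCL) (RLCGraph.sqrtE N.supCL))ᶜ) :=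
  mainTheorem2_general N hconn hfin a B ha hR
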